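/- **Setting.** Let $0\le T<\infty$, let $(\Omega,\mathscr F,\mathbb P)$ be a complete probability space carrying an $(m+n)$-dimensional standard Brownian motion $\overline W=(W,W^\perp)$ on $[0,T]$ ($W$ the first $m$ components), and let $(\mathcal F_t)_{0\le t\le T}$ be the filtration generated by $\overline W$, augmented by the $\mathbb P$-null sets. There are $m$ traded assets with prices $S_t=S_0+\int_0^t\lambda_s\,ds+W_t$, where $S_0\in\mathbb R^m$ and $\lambda$ is a bounded $\mathbb R^m$-valued process, predictable with respect to $\mathcal F^W_t=\sigma(W_s,0\le s\le t)$. Let $\mathcal M$ be the set of probability measures $\mathbb Q$ on $(\Omega,\mathcal F_T)$, equivalent to $\mathbb P$, under which $S$ is a local martingale, and let $\mathbb Q^{min}$ be the minimal martingale measure $$\frac{d\mathbb Q^{min}}{d\mathbb P}=\exp\Big(-\int_0^T\lambda_s\cdot dW_s-\frac12\int_0^T|\lambda_s|^2ds\Big).$$ Let $q>0$, $q\ne1$. Put $\ln_q x=\frac{x^{1-q}-1}{1-q}$ (for $x\ge0$ if $q<1$, for $x>0$ if $q>1$) and $\exp_q x=[1+(1-q)x]^{\frac1{1-q}}$ (for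 $x\ge-\frac1{1-q}$ if $q<1$, for $x<-\frac1{1-q}$ if $q>1$). For $\mathbb Q\in\mathcal M$ let $D_t=\mathbb E_{\mathbb Q^{min}}\big[\frac{d\mathbb Q}{d\mathbb Q^{min}}\,\big|\,\mathcal F_t\big]$ and $D_{t,T}=D_T/D_t$, and let $$H_q(\mathbb Q|\mathbb Q^{min})=\mathbb E_{\mathbb Q^{min}}\big[D_T^{\,q}\ln_q D_T\big],\qquad H_{q,t}(\mathbb Q|\mathbb Q^{min})=\mathbb E_{\mathbb Q^{min}}\big[D_{t,T}^{\,q}\ln_q D_{t,T}\,\big|\,\mathcal F_t\big]$$ be the (conditional) Tsallis relative entropy; let $\mathcal M_f=\{\mathbb Q\in\mathcal M: H_q(\mathbb Q|\mathbb Q^{min})<\infty\}$. Here a conditional expectation $\mathbb E[X|\mathcal F_t]$ of a possibly non-integrable $X$ means $\mathbb E[X^+|\mathcal F_t]-\mathbb E[X^-|\mathcal F_t]$. For $\gamma>0$ let $\mathcal L_q^\gamma(\mathcal F_T,b)$ be the set of $\mathcal F_T$-measurable real random variables $\xi$ such that $\exp_q(-\gamma\xi)$ is well defined a.s., $\exp_q(-\gamma\xi)\in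 L^1(\mathbb P)$, $\mathbb E_{\mathbb P}[\exp_q(-\gamma\xi)]$ lies in the domain of $\ln_q$, and $m_1\le\exp_q(-\gamma\xi)\le m_2$ a.s. for some constants $m_1>0$ and $m_2$. For $\xi\in\mathcal L_q^\gamma(\mathcal F_T,b)$ and $t\in[0,T]$ define the pricing principle $$F_t(\xi,\gamma)=\operatorname*{ess\,inf}_{\mathbb Q\in\mathcal M_f}\Big(\mathbb E_{\mathbb Q^{min}}\big[D_{t,T}^{\,q}\,\xi\,\big|\,\mathcal F_t\big]+\frac1\gamma H_{q,t}(\mathbb Q|\mathbb Q^{min})\Big).$$ **Proposition.** For every $t\in[0,T]$: (i) $F_t(\xi,\gamma)$ is decreasing in $\gamma$: if $0<\gamma\le\gamma'$ and $\xi\in\mathcal L_q^{\gamma}(\mathcal F_T,b)\cap\mathcal L_q^{\gamma'}(\mathcal F_T,b)$, then $F_t(\xi,\gamma')\le F_t(\xi,\gamma)$ $\mathbb P$-a.s. (ii) If $\gamma>0$, $\kappa>0$ and $\kappa\xi\in\mathcal L_q^{\gamma}(\mathcal F_T,b)$, then $\xi\in\mathcal L_q^{\kappa\gamma}(\mathcal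 F_T,b)$ and $F_t(\kappa\xi,\gamma)=\kappa F_t(\xi,\kappa\gamma)$ $\mathbb P$-a.s. -/

import Mathlib

open MeasureTheory ProbabilityTheory Filter Set
open scoped NNReal ENNReal Topology MeasureTheory

noncomputable section

namespace TsallisPricing

/-! ### The `q`-logarithm and the `q`-exponential -/

/-- The domain of `ln_q`: `[0, ∞)` for `q < 1` and `(0, ∞)` for `q > 1`. -/
def domLnq (q : ℝ) : Set ℝ := {x | (q < 1 → 0 ≤ x) ∧ (1 < q → 0 < x)}

/-- The `q`-logarithm; it is only meaningful on `domLnq q`. -/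
def lnq (q x : ℝ) : ℝ := (x ^ (1 - q) - 1) / (1 - q)

/-- The domain of `exp_q`: `[-1/(1-q), ∞)` for `q < 1` and `(-∞, -1/(1-q))` for `q > 1`. -/
def domExpq (q : ℝ) : Set ℝ :=
  {x | (q < 1 → -1 / (1 - q) ≤ x) ∧ (1 < q → x < -1 / (1 - q))}

/-- The `q`-exponential; it is only meaningful on `domExpq q`. -/
def expq (q x : ℝ) : ℝ := (1 + (1 - q) * x) ^ (1 / (1 - q))

/-! ### Essential infimum of a family of random variables -/

/-- `Y` is an essential infimum of the family `S` of extended random variables: a random variable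
which is almost surely below every member of `S`, and almost surely above any other such. -/
structure IsEssInfFamily {Ω : Type*} {mΩ : MeasurableSpace Ω} (μ : Measure Ω)
    (S : Set (Ω → EReal)) (Y : Ω → EReal) : Prop where
  measurable : Measurable Y
  le : ∀ X ∈ S, Y ≤ᵐ[μ] X
  greatest : ∀ Z : Ω → EReal, Measurable Z → (∀ X ∈ S, Z ≤ᵐ[μ] X) → Z ≤ᵐ[μ] Y

/-- Every family of extended random variables on a finite measure space has an essential
infimum. -/
theorem exists_isEssInfFamily {Ω : Type*} {mΩ : MeasurableSpace Ω} (μ : Measure Ω)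
    [IsFiniteMeasure μ] (S : Set (Ω → EReal)) : ∃ Y, IsEssInfFamily μ S Y := by
  let φ : EReal → ℝ≥0∞ := fun x => (ENNReal.orderIsoIicOneBirational (EReal.exp x) : ℝ≥0∞)
  have hφ : StrictMono φ := fun a b hab =>
    ENNReal.orderIsoIicOneBirational.strictMono (EReal.exp_strictMono hab)
  have hφm : Measurable φ := hφ.monotone.measurable
  have hφ1 : ∀ x, φ x ≤ 1 := fun x => (ENNReal.orderIsoIicOneBirational (EReal.exp x)).2
  have hfin : ∀ Z : Ω → EReal, ∫⁻ ω, φ (Z ω) ∂μ ≠ ∞ := by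
    intro Z
    refine ne_top_of_le_ne_top (measure_ne_top μ univ) ?_
    calc ∫⁻ ω, φ (Z ω) ∂μ ≤ ∫⁻ _, 1 ∂μ := lintegral_mono fun ω => hφ1 _
      _ = μ univ := by simp
  let L : Set (Ω → EReal) := {Z | Measurable Z ∧ ∀ X ∈ S, Z ≤ᵐ[μ] X}
  let V : Set ℝ≥0∞ := (fun Z : Ω → EReal => ∫⁻ ω, φ (Z ω) ∂μ) '' L
  have hV : V.Nonempty :=
    ⟨_, fun _ => ⊥, ⟨measurable_const, fun X _ => Eventually.of_forall fun _ => bot_le⟩, rfl⟩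
  obtain ⟨u, -, hu, huV⟩ := exists_seq_tendsto_sSup hV (OrderTop.bddAbove V)
  choose Z hZL hZu using huV
  let Y : Ω → EReal := fun ω => ⨆ n, Z n ω
  have hYm : Measurable Y := Measurable.iSup fun n => (hZL n).1
  have hYle : ∀ X ∈ S, Y ≤ᵐ[μ] X := by
    intro X hX
    have h : ∀ᵐ ω ∂μ, ∀ n, Z n ω ≤ X ω := ae_all_iff.2 fun n => (hZL n).2 X hX
    filter_upwards [h] with ω hω using iSup_le hω
  have hsup : sSup V ≤ ∫⁻ ω, φ (Y ω) ∂μ := by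
    refine le_of_tendsto' hu fun n => ?_
    rw [← hZu n]
    exact lintegral_mono fun ω => hφ.monotone (le_iSup (fun n => Z n ω) n)
  refine ⟨Y, hYm, hYle, fun Z' hZ'm hZ' => ?_⟩
  have hL : (fun ω => Y ω ⊔ Z' ω) ∈ L := by
    refine ⟨hYm.sup hZ'm, fun X hX => ?_⟩
    filter_upwards [hYle X hX, hZ' X hX] with ω h1 h2 using sup_le h1 h2
  have hle : ∫⁻ ω, φ (Y ω ⊔ Z' ω) ∂μ ≤ ∫⁻ ω, φ (Y ω) ∂μ :=
    (le_sSup (mem_image_of_mem _ hL)).trans hsup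
  have hae := ae_eq_of_ae_le_of_lintegral_le (μ := μ)
    (f := fun ω => φ (Y ω)) (g := fun ω => φ (Y ω ⊔ Z' ω))
    (Eventually.of_forall fun ω => hφ.monotone le_sup_left) (hfin Y)
    (hφm.comp (hYm.sup hZ'm)).aemeasurable hle
  filter_upwards [hae] with ω hω
  have := hφ.injective hω
  rw [this]
  exact le_sup_right

/-- The essential infimum (unique up to null sets) of a family of extended random variables. -/
def essInfFamily {Ω : Type*} {mΩ : MeasurableSpace Ω} (μ : Measure Ω) [IsFiniteMeasure μ]
    (S : Set (Ω → EReal)) : Ω → EReal :=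
  Classical.choose (exists_isEssInfFamily μ S)

/-! ### Extended expectations, density processes, Tsallis relative entropy -/

/-- The expectation `E[X⁺] - E[X⁻]`, with values in `[-∞, ∞]`. -/
def extExp {Ω : Type*} {mΩ : MeasurableSpace Ω} (μ : Measure Ω) (X : Ω → ℝ) : EReal :=
  ((∫⁻ ω, ENNReal.ofReal (X ω) ∂μ : ℝ≥0∞) : EReal) -
    ((∫⁻ ω, ENNReal.ofReal (-X ω) ∂μ : ℝ≥0∞) : EReal)

/-- The conditional expectation `E[X⁺ | 𝒢] - E[X⁻ | 𝒢]`, with values in `[-∞, ∞]`. It does not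
require `X` to be integrable. -/
def extCondExp {Ω : Type*} {mΩ : MeasurableSpace Ω} (μ : Measure Ω) (𝒢 : MeasurableSpace Ω)
    (X : Ω → ℝ) : Ω → EReal := fun ω =>
  ((condLExp 𝒢 μ (fun ω => ENNReal.ofReal (X ω)) ω : ℝ≥0∞) : EReal) -
    ((condLExp 𝒢 μ (fun ω => ENNReal.ofReal (-X ω)) ω : ℝ≥0∞) : EReal)

/-- The density process `D_t = E_μ[dQ/dμ | 𝓕_t]`. -/
def densityAt {Ω : Type*} {mΩ : MeasurableSpace Ω} (𝓕 : Filtration ℝ≥0 mΩ) (Q μ : Measure Ω)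
    (t : ℝ≥0) : Ω → ℝ :=
  condExp (𝓕 t) μ (fun ω => (Q.rnDeriv μ ω).toReal)

/-- The ratio `D_{s,t} = D_t / D_s`. -/
def densityRatio {Ω : Type*} {mΩ : MeasurableSpace Ω} (𝓕 : Filtration ℝ≥0 mΩ) (Q μ : Measure Ω)
    (s t : ℝ≥0) : Ω → ℝ := fun ω =>
  densityAt 𝓕 Q μ t ω / densityAt 𝓕 Q μ s ω

open Classical in
/-- The Tsallis relative entropy `H_q(Q | μ)`. -/
def tsallisEntropy {Ω : Type*} {mΩ : MeasurableSpace Ω} (q : ℝ) (Q μ : Measure Ω) : EReal :=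
  if Q ≪ μ then
    extExp μ (fun ω => (Q.rnDeriv μ ω).toReal ^ q * lnq q (Q.rnDeriv μ ω).toReal)
  else ⊤

/-- The conditional Tsallis relative entropy
`H_{q,t}(Q | μ) = E_μ[(D_{t,T})^q ln_q D_{t,T} | 𝓕_t]`. -/
def condTsallisEntropy {Ω : Type*} {mΩ : MeasurableSpace Ω} (𝓕 : Filtration ℝ≥0 mΩ) (T : ℝ≥0)
    (q : ℝ) (Q μ : Measure Ω) (t : ℝ≥0) : Ω → EReal :=
  extCondExp μ (𝓕 t)
    (fun ω => densityRatio 𝓕 Q μ t T ω ^ q * lnq q (densityRatio 𝓕 Q μ t T ω))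

/-! ### Brownian motion on `[0,T]` and its filtrations -/

/-- `B` is a `d`-dimensional standard Brownian motion on the time interval `[0,T]`. -/
structure IsStandardBM {Ω : Type*} {mΩ : MeasurableSpace Ω} (P : Measure Ω) (T : ℝ≥0) {d : ℕ}
    (B : ℝ≥0 → Ω → EuclideanSpace ℝ (Fin d)) : Prop where
  measurable : ∀ t ≤ T, Measurable (B t)
  zero : ∀ᵐ ω ∂P, B 0 ω = 0
  cont : ∀ᵐ ω ∂P, ContinuousOn (fun t => B t ω) (Iic T)
  law : ∀ s t, s ≤ t → t ≤ T →
    HasLaw (fun ω (i : Fin d) => B t ω i - B s ω i)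
      (Measure.pi fun _ : Fin d => gaussianReal 0 (t - s)) P
  indep : ∀ s t, s ≤ t → t ≤ T →
    Indep (⨆ u ∈ Iic s, MeasurableSpace.comap (B u) inferInstance)
      (MeasurableSpace.comap (fun ω => B t ω - B s ω) inferInstance) P

/-- The σ-algebra `σ(B_u, u ≤ min t T)`. -/
abbrev pastSigma {Ω E : Type*} [MeasurableSpace E] (B : ℝ≥0 → Ω → E) (T t : ℝ≥0) :
    MeasurableSpace Ω :=
  ⨆ u ∈ Iic (min t T), MeasurableSpace.comap (B u) inferInstance

theorem pastSigma_mono {Ω E : Type*} [MeasurableSpace E] (B : ℝ≥0 → Ω → E) (T : ℝ≥0) {s t : ℝ≥0}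
    (h : s ≤ t) : pastSigma B T s ≤ pastSigma B T t :=
  biSup_mono fun _ hu => le_trans hu (min_le_min_right T h)

theorem pastSigma_le {Ω E : Type*} [MeasurableSpace E] {mΩ : MeasurableSpace Ω}
    {B : ℝ≥0 → Ω → E} {T : ℝ≥0} (hB : ∀ t ≤ T, Measurable (B t)) (t : ℝ≥0) :
    pastSigma B T t ≤ mΩ :=
  iSup₂_le fun u hu => (hB u (le_trans hu (min_le_right t T))).comap_le

/-- The raw filtration `t ↦ σ(B_u, u ≤ t)`, `t ∈ [0,T]`, kept constant after `T`. -/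
def rawFiltration {Ω E : Type*} [MeasurableSpace E] {mΩ : MeasurableSpace Ω}
    (B : ℝ≥0 → Ω → E) (T : ℝ≥0) (hB : ∀ t ≤ T, Measurable (B t)) : Filtration ℝ≥0 mΩ where
  seq := pastSigma B T
  mono' _ _ h := pastSigma_mono B T h
  le' := pastSigma_le hB

/-- The σ-algebra generated by the `P`-null sets. -/
abbrev nullSigma {Ω : Type*} {mΩ : MeasurableSpace Ω} (P : Measure Ω) : MeasurableSpace Ω :=
  MeasurableSpace.generateFrom {N | P N = 0}

/-- `σ(B_u, u ≤ min t T)`, augmented by the `P`-null sets. -/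
abbrev augSigma {Ω E : Type*} [MeasurableSpace E] {mΩ : MeasurableSpace Ω} (P : Measure Ω)
    (B : ℝ≥0 → Ω → E) (T t : ℝ≥0) : MeasurableSpace Ω :=
  pastSigma B T t ⊔ nullSigma P

theorem augSigma_le_terminal {Ω E : Type*} [MeasurableSpace E] {mΩ : MeasurableSpace Ω}
    (P : Measure Ω) (B : ℝ≥0 → Ω → E) (T t : ℝ≥0) : augSigma P B T t ≤ augSigma P B T T := by
  refine sup_le_sup_right ?_ _
  refine biSup_mono fun u hu => ?_
  have h : u ≤ min t T := hu
  exact le_trans h (le_min (min_le_right t T) (min_le_right t T))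

/-- The augmented filtration generated by `B` on `[0,T]`, kept constant after `T`, as a filtration
of the measurable space `(Ω, 𝓕_T)`. -/
def augFiltration {Ω E : Type*} [MeasurableSpace E] {mΩ : MeasurableSpace Ω} (P : Measure Ω)
    (B : ℝ≥0 → Ω → E) (T : ℝ≥0) : Filtration ℝ≥0 (augSigma P B T T) where
  seq := augSigma P B T
  mono' _ _ h := sup_le_sup_right (pastSigma_mono B T h) _
  le' := augSigma_le_terminal P B T

theorem augSigma_le {Ω E : Type*} [MeasurableSpace E] {mΩ : MeasurableSpace Ω} {P : Measure Ω}
    [P.IsComplete] {B : ℝ≥0 → Ω → E} {T : ℝ≥0} (hB : ∀ t ≤ T, Measurable (B t)) (t : ℝ≥0) :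
    augSigma P B T t ≤ mΩ :=
  sup_le (pastSigma_le hB t)
    (MeasurableSpace.generateFrom_le fun N hN => Measure.IsComplete.out' N hN)

/-! ### The Itô integral -/

/-- An elementary (bounded, piecewise constant, predictable) integrand on `[0,T]`:
`∑_{i < N} c_i 1_{(t_i, t_{i+1}]}` with `c_i` bounded and `𝓕_{t_i}`-measurable. -/
structure ElementaryIntegrand {Ω : Type*} {mΩ : MeasurableSpace Ω} (𝓕 : Filtration ℝ≥0 mΩ)
    (T : ℝ≥0) (d : ℕ) where
  N : ℕ
  time : ℕ → ℝ≥0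
  time_mono : Monotone time
  time_le : ∀ i, time i ≤ T
  coef : ℕ → Ω → EuclideanSpace ℝ (Fin d)
  coef_meas : ∀ i, StronglyMeasurable[𝓕 (time i)] (coef i)
  coef_bdd : ∃ C : ℝ, ∀ i ω, ‖coef i ω‖ ≤ C

/-- The value of an elementary integrand at time `s`. -/
def ElementaryIntegrand.val {Ω : Type*} {mΩ : MeasurableSpace Ω} {𝓕 : Filtration ℝ≥0 mΩ}
    {T : ℝ≥0} {d : ℕ} (H : ElementaryIntegrand 𝓕 T d) (s : ℝ≥0) (ω : Ω) :
    EuclideanSpace ℝ (Fin d) :=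
  ∑ i ∈ Finset.range H.N, (Ioc (H.time i) (H.time (i + 1))).indicator (fun _ => H.coef i ω) s

/-- The elementary stochastic integral `∑_{i < N} c_i · (B_{t_{i+1}} - B_{t_i})`. -/
def ElementaryIntegrand.integral {Ω : Type*} {mΩ : MeasurableSpace Ω} {𝓕 : Filtration ℝ≥0 mΩ}
    {T : ℝ≥0} {d : ℕ} (H : ElementaryIntegrand 𝓕 T d) (B : ℝ≥0 → Ω → EuclideanSpace ℝ (Fin d))
    (ω : Ω) : ℝ :=
  ∑ i ∈ Finset.range H.N, inner ℝ (H.coef i ω) (B (H.time (i + 1)) ω - B (H.time i) ω)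

/-- `I` is the Itô integral `∫_0^T h_s · dB_s`: the `L²(μ)`-limit of the elementary integrals of
elementary integrands converging to `h` in `L²(ds ⊗ dμ)`. -/
def IsItoIntegral {Ω : Type*} {mΩ : MeasurableSpace Ω} (𝓕 : Filtration ℝ≥0 mΩ) (μ : Measure Ω)
    (T : ℝ≥0) {d : ℕ} (h B : ℝ≥0 → Ω → EuclideanSpace ℝ (Fin d)) (I : Ω → ℝ) : Prop :=
  Measurable I ∧ ∃ H : ℕ → ElementaryIntegrand 𝓕 T d,
    Tendsto (fun k => ∫⁻ ω, (∫⁻ s in Ioc (0 : ℝ) T,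
      ‖(H k).val s.toNNReal ω - h s.toNNReal ω‖ₑ ^ 2) ∂μ) atTop (𝓝 0) ∧
    Tendsto (fun k => ∫⁻ ω, ‖(H k).integral B ω - I ω‖ₑ ^ 2 ∂μ) atTop (𝓝 0)

open Classical in
/-- The Itô integral `∫_0^T h_s · dB_s` (unique up to null sets). It exists whenever `B` is a
Brownian motion for `𝓕` and `h` is predictable and square integrable, in particular if `h` is
predictable and bounded. -/
def itoIntegral {Ω : Type*} {mΩ : MeasurableSpace Ω} (𝓕 : Filtration ℝ≥0 mΩ) (μ : Measure Ω)
    (T : ℝ≥0) {d : ℕ} (h B : ℝ≥0 → Ω → EuclideanSpace ℝ (Fin d)) : Ω → ℝ :=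
  if hI : ∃ I, IsItoIntegral 𝓕 μ T h B I then Classical.choose hI else 0

/-! ### The market -/

/-- The first `m` coordinates of a vector of `ℝ^{m+n}`. -/
def firstCoords {m n : ℕ} (x : EuclideanSpace ℝ (Fin (m + n))) : EuclideanSpace ℝ (Fin m) :=
  WithLp.toLp 2 fun i => x (Fin.castAdd n i)

theorem measurable_firstCoords {m n : ℕ} :
    Measurable (firstCoords : EuclideanSpace ℝ (Fin (m + n)) → EuclideanSpace ℝ (Fin m)) := by
  unfold firstCoords
  fun_prop

/-- The market on `[0,T]`: an `(m+n)`-dimensional standard Brownian motion `Wbar = (W, W^⊥)`, the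
initial prices `S0` of the `m` traded assets, and their drift `lam`, a bounded process which is
predictable for the filtration `σ(W_u, u ≤ t)`. -/
structure Market {Ω : Type*} {mΩ : MeasurableSpace Ω} (P : Measure Ω) (m n : ℕ) where
  T : ℝ≥0
  Wbar : ℝ≥0 → Ω → EuclideanSpace ℝ (Fin (m + n))
  isBM : IsStandardBM P T Wbar
  S0 : EuclideanSpace ℝ (Fin m)
  lam : ℝ≥0 → Ω → EuclideanSpace ℝ (Fin m)
  lam_bdd : ∃ C : ℝ, ∀ t ≤ T, ∀ ω, ‖lam t ω‖ ≤ C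
  lam_predictable : IsStronglyPredictable
    (rawFiltration (fun t ω => firstCoords (Wbar t ω)) T
      (fun t ht => measurable_firstCoords.comp (isBM.measurable t ht))) lam

namespace Market

/-- The first `m` components `W` of the Brownian motion. -/
def W {Ω : Type*} {mΩ : MeasurableSpace Ω} {P : Measure Ω} {m n : ℕ} (M : Market P m n) :
    ℝ≥0 → Ω → EuclideanSpace ℝ (Fin m) :=
  fun t ω => firstCoords (M.Wbar t ω)

/-- The σ-algebra `𝓕_T`. -/
abbrev sigmaT {Ω : Type*} {mΩ : MeasurableSpace Ω} {P : Measure Ω} {m n : ℕ} (M : Market P m n) :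
    MeasurableSpace Ω :=
  augSigma P M.Wbar M.T M.T

/-- The filtration `(𝓕_t)`, the augmented filtration generated by `Wbar`. -/
abbrev filtration {Ω : Type*} {mΩ : MeasurableSpace Ω} {P : Measure Ω} {m n : ℕ}
    (M : Market P m n) : Filtration ℝ≥0 M.sigmaT :=
  augFiltration P M.Wbar M.T

/-- The restriction of `P` to `𝓕_T`. -/
abbrev PT {Ω : Type*} {mΩ : MeasurableSpace Ω} {P : Measure Ω} [P.IsComplete] {m n : ℕ}
    (M : Market P m n) : @Measure Ω M.sigmaT :=
  P.trim (augSigma_le (M.isBM.measurable) M.T)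

/-- The asset prices `S_t = S_0 + ∫_0^t λ_s ds + W_t`, stopped at `T`. -/
def S {Ω : Type*} {mΩ : MeasurableSpace Ω} {P : Measure Ω} {m n : ℕ} (M : Market P m n)
    (t : ℝ≥0) (ω : Ω) : EuclideanSpace ℝ (Fin m) :=
  M.S0 + (∫ s in (0 : ℝ)..(min t M.T : ℝ≥0), M.lam s.toNNReal ω) + M.W (min t M.T) ω

/-- The minimal martingale measure on `(Ω, 𝓕_T)`, with density
`exp(-∫_0^T λ_s · dW_s - (1/2) ∫_0^T |λ_s|² ds)` with respect to `P`. -/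
def Qmin {Ω : Type*} {mΩ : MeasurableSpace Ω} {P : Measure Ω} [P.IsComplete] {m n : ℕ}
    (M : Market P m n) : @Measure Ω M.sigmaT :=
  @Measure.withDensity Ω M.sigmaT M.PT fun ω => ENNReal.ofReal (Real.exp
    (-itoIntegral M.filtration M.PT M.T M.lam M.W ω
      - 1 / 2 * ∫ s in (0 : ℝ)..M.T, ‖M.lam s.toNNReal ω‖ ^ 2))

/-- The set `ℳ` of equivalent local martingale measures: the probability measures on `(Ω, 𝓕_T)`
which are equivalent to `P` and under which the price process is a local martingale. -/
def martingaleMeasures {Ω : Type*} {mΩ : MeasurableSpace Ω} {P : Measure Ω} [P.IsComplete]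
    {m n : ℕ} (M : Market P m n) : Set (@Measure Ω M.sigmaT) :=
  {Q | IsProbabilityMeasure Q ∧ Q ≪ M.PT ∧ M.PT ≪ Q ∧
    Locally (fun X => Martingale X M.filtration Q) M.filtration M.S Q}

/-- The set `ℳ_f` of those `Q ∈ ℳ` with `H_q(Q | Q^min) < ∞`. -/
def finiteEntropyMeasures {Ω : Type*} {mΩ : MeasurableSpace Ω} {P : Measure Ω} [P.IsComplete]
    {m n : ℕ} (M : Market P m n) (q : ℝ) : Set (@Measure Ω M.sigmaT) :=
  {Q | Q ∈ M.martingaleMeasures ∧ tsallisEntropy q Q M.Qmin < ⊤}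

/-- The claims `ℒ_q^γ(𝓕_T)`: `exp_q(-γ ξ)` is well defined and integrable, with expectation in the
domain of `ln_q`. -/
def claims {Ω : Type*} {mΩ : MeasurableSpace Ω} {P : Measure Ω} {m n : ℕ}
    (M : Market P m n) (q γ : ℝ) : Set (Ω → ℝ) :=
  {ξ | Measurable[M.sigmaT] ξ ∧ (∀ᵐ ω ∂P, -γ * ξ ω ∈ domExpq q) ∧
    Integrable (fun ω => expq q (-γ * ξ ω)) P ∧ ∫ ω, expq q (-γ * ξ ω) ∂P ∈ domLnq q}

/-- The `q`-exponentially bounded claims `ℒ_q^γ(𝓕_T, b)`. -/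
def boundedClaims {Ω : Type*} {mΩ : MeasurableSpace Ω} {P : Measure Ω} {m n : ℕ}
    (M : Market P m n) (q γ : ℝ) : Set (Ω → ℝ) :=
  {ξ | ξ ∈ M.claims q γ ∧ ∃ m₁ m₂ : ℝ, 0 < m₁ ∧
    ∀ᵐ ω ∂P, m₁ ≤ expq q (-γ * ξ ω) ∧ expq q (-γ * ξ ω) ≤ m₂}

/-- The robust evaluation of `ξ` under a single `Q`:
`E_{Q^min}[(D_{t,T})^q ξ | 𝓕_t] + (1/γ) H_{q,t}(Q | Q^min)` with `D = D^{Q, Q^min}`. -/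
def penalizedValue {Ω : Type*} {mΩ : MeasurableSpace Ω} {P : Measure Ω} [P.IsComplete]
    {m n : ℕ} (M : Market P m n) (q : ℝ) (t : ℝ≥0) (ξ : Ω → ℝ) (γ : ℝ)
    (Q : @Measure Ω M.sigmaT) : Ω → EReal := fun ω =>
  extCondExp M.Qmin (M.filtration t)
      (fun ω => densityRatio M.filtration Q M.Qmin t M.T ω ^ q * ξ ω) ω +
    ((1 / γ : ℝ) : EReal) * condTsallisEntropy M.filtration M.T q Q M.Qmin t ω

/-- The pricing principle `F_t(ξ, γ)`: the essential infimum over `Q ∈ ℳ_f` of the penalized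
values of `ξ`. -/
def price {Ω : Type*} {mΩ : MeasurableSpace Ω} {P : Measure Ω} [IsProbabilityMeasure P]
    [P.IsComplete] {m n : ℕ} (M : Market P m n) (q : ℝ) (t : ℝ≥0) (ξ : Ω → ℝ) (γ : ℝ) :
    Ω → EReal :=
  essInfFamily M.PT {X | ∃ Q ∈ M.finiteEntropyMeasures q, X = M.penalizedValue q t ξ γ Q}

end Market

end TsallisPricing

end

/-! Both claims are proved for each `Q` in `ℳ_f` separately and then passed to the essential
infimum. The set `ℳ_f` does not depend on `γ` or `ξ`. (i) Only the factor `1/γ` depends on `γ`, so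
monotonicity amounts to nonnegativity of the conditional entropy. The function `x ^ q * ln_q x` lies
above its tangent `x - 1` at `1`, and `D_{t,T}` has conditional mean one, so conditioning gives
`H_{q,t} ≥ 0`. (ii) `1/γ = κ · 1/(κγ)`, and the extended conditional expectation is positively
homogeneous; hence the penalized value of `κξ` at `γ` is `κ` times that of `ξ` at `κγ`, and a factor
`κ > 0` commutes with essential infima. Conditional expectations are `[-∞, ∞]`-valued, so both
arguments use only the `EReal` arithmetic that survives infinite values. -/

namespace TsallisPricing

/-! ### Conditional Lebesgue expectations -/

section CondLExp

variable {Ω : Type*} {m mΩ : MeasurableSpace Ω} {μ : Measure Ω}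

/-- Pull-out property, in integrated form. -/
theorem setLIntegral_mul_condLExp (hm : m ≤ mΩ) [SigmaFinite (μ.trim hm)] {X Y : Ω → ℝ≥0∞}
    (hX : Measurable X) (hY : Measurable[m] Y) {s : Set Ω} (hs : MeasurableSet[m] s) :
    ∫⁻ ω in s, condLExp m μ X ω * Y ω ∂μ = ∫⁻ ω in s, X ω * Y ω ∂μ := by
  -- Weighting `μ` by `X` or by its conditional expectation gives the same measure on `m`, and `Y`
  -- only sees that restriction. No integrability is needed.
  have htrim : (μ.withDensity (condLExp m μ X)).trim hm = (μ.withDensity X).trim hm := by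
    refine @Measure.ext _ m _ _ fun u hu => ?_
    rw [trim_measurableSet_eq hm hu, trim_measurableSet_eq hm hu,
      withDensity_apply _ (hm u hu), withDensity_apply _ (hm u hu),
      setLIntegral_condLExp hm μ X hu]
  have hmul : ∀ Z : Ω → ℝ≥0∞, Measurable Z →
      ∫⁻ ω in s, Z ω * Y ω ∂μ = ∫⁻ ω in s, Y ω ∂((μ.withDensity Z).trim hm) := by
    intro Z hZ
    rw [setLIntegral_trim hm hY hs,
      setLIntegral_withDensity_eq_setLIntegral_mul μ hZ (hY.mono hm le_rfl) (hm s hs)]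
    rfl
  rw [hmul _ (measurable_condLExp' m μ X), hmul _ hX, htrim]

/-- Pull-out property of the conditional Lebesgue expectation. -/
theorem condLExp_mul_of_measurable_right (hm : m ≤ mΩ) [SigmaFinite (μ.trim hm)]
    {X Y : Ω → ℝ≥0∞} (hX : Measurable X) (hY : Measurable[m] Y) :
    condLExp m μ (fun ω => X ω * Y ω) =ᵐ[μ] fun ω => condLExp m μ X ω * Y ω :=
  (ae_eq_condLExp hm μ _ ((measurable_condLExp m μ X).mul hY) fun _ hs =>
    setLIntegral_mul_condLExp hm hX hY hs).symm

theorem condLExp_pos (hm : m ≤ mΩ) [SigmaFinite (μ.trim hm)] {X : Ω → ℝ≥0∞} (hX : Measurable X)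
    (hpos : ∀ᵐ ω ∂μ, 0 < X ω) : ∀ᵐ ω ∂μ, 0 < condLExp m μ X ω := by
  have hs : MeasurableSet[m] {ω | condLExp m μ X ω = 0} :=
    measurable_condLExp m μ X (measurableSet_singleton 0)
  -- The zero set is in `m`, so `X` has integral zero on it; as `X > 0` a.e., the set is null.
  have h0 : ∫⁻ ω in {ω | condLExp m μ X ω = 0}, X ω ∂μ = 0 := by
    rw [← setLIntegral_condLExp hm μ X hs]
    exact setLIntegral_eq_zero (hm _ hs) fun ω hω => hω
  have h1 := (ae_restrict_iff' (hm _ hs)).1 ((lintegral_eq_zero_iff hX).1 h0)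
  filter_upwards [h1, hpos] with ω h h'
  exact pos_iff_ne_zero.2 fun h0 => h'.ne' (h h0)

/-- If `X` dominates `D - 1`, where `D ≥ 0` has conditional expectation one, then the extended
conditional expectation of `X` is nonnegative. -/
theorem extCondExp_nonneg_of_sub_one_le (hm : m ≤ mΩ) [SigmaFinite (μ.trim hm)] {X D : Ω → ℝ}
    (hDm : Measurable D) (hD0 : 0 ≤ᵐ[μ] D)
    (hD : condLExp m μ (fun ω => ENNReal.ofReal (D ω)) =ᵐ[μ] 1)
    (hX : ∀ᵐ ω ∂μ, D ω - 1 ≤ X ω) : 0 ≤ᵐ[μ] extCondExp μ m X := by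
  -- `D ≥ 0` gives `X⁻ ≤ 1`; the subtracted term is therefore finite and `∞ - ∞` cannot occur.
  have hneg : condLExp m μ (fun ω => ENNReal.ofReal (-X ω)) ≤ᵐ[μ] condLExp m μ 1 := by
    refine condLExp_mono ?_
    filter_upwards [hX, hD0] with ω h h0
    have h0' : 0 ≤ D ω := h0
    exact ENNReal.ofReal_le_one.2 (by linarith)
  -- `D - 1 ≤ X` written without subtraction: `X⁻ + D ≤ X⁺ + 1`. After conditioning, `D` becomes `1`
  -- and cancels.
  have hle : condLExp m μ ((fun ω => ENNReal.ofReal (-X ω)) + fun ω => ENNReal.ofReal (D ω))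
      ≤ᵐ[μ] condLExp m μ ((fun ω => ENNReal.ofReal (X ω)) + 1) := by
    refine condLExp_mono ?_
    filter_upwards [hX, hD0] with ω h h0
    have h0' : 0 ≤ D ω := h0
    simp only [Pi.add_apply, Pi.one_apply]
    rcases le_total 0 (X ω) with hx | hx
    · rw [ENNReal.ofReal_of_nonpos (neg_nonpos.2 hx), zero_add, ← ENNReal.ofReal_one,
        ← ENNReal.ofReal_add hx zero_le_one]
      exact ENNReal.ofReal_le_ofReal (by linarith)
    · rw [ENNReal.ofReal_of_nonpos hx, zero_add, ← ENNReal.ofReal_one,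
        ← ENNReal.ofReal_add (neg_nonneg.2 hx) h0']
      exact ENNReal.ofReal_le_ofReal (by linarith)
  have hadd := condLExp_add_right (mΩ := m) (P := μ) (fun ω => ENNReal.ofReal (-X ω))
    hDm.ennreal_ofReal.aemeasurable
  have hadd' := condLExp_add_right (mΩ := m) (P := μ) (fun ω => ENNReal.ofReal (X ω))
    (Y := 1) aemeasurable_const
  rw [condLExp_one hm] at hadd' hneg
  filter_upwards [hneg, hle, hadd, hadd', hD] with ω h1 h2 h3 h4 h5
  rw [h3, h4, Pi.add_apply, Pi.add_apply, h5] at h2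
  have h6 := (ENNReal.add_le_add_iff_right ENNReal.one_ne_top).1 h2
  have htop : condLExp m μ (fun ω => ENNReal.ofReal (-X ω)) ω ≠ ∞ :=
    ne_top_of_le_ne_top ENNReal.one_ne_top h1
  have htop' : ((condLExp m μ (fun ω => ENNReal.ofReal (-X ω)) ω : ℝ≥0∞) : EReal) ≠ ⊤ := by
    simpa using htop
  exact (EReal.sub_nonneg (.inr htop') (.inr (EReal.coe_ennreal_ne_bot _))).2
    (EReal.coe_ennreal_le_coe_ennreal_iff.2 h6)

/-- The extended conditional expectation is positively homogeneous. -/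
theorem extCondExp_const_mul {κ : ℝ} (hκ : 0 < κ) (X : Ω → ℝ) :
    extCondExp μ m (fun ω => κ * X ω) =ᵐ[μ] fun ω => (κ : EReal) * extCondExp μ m X ω := by
  have hmul : ∀ Y : Ω → ℝ, (fun ω => ENNReal.ofReal (κ * Y ω))
      = ENNReal.ofReal κ • fun ω => ENNReal.ofReal (Y ω) := by
    intro Y
    ext ω
    simp [ENNReal.ofReal_mul hκ.le]
  have hcoe : ((ENNReal.ofReal κ : ℝ≥0∞) : EReal) = (κ : EReal) := by
    rw [EReal.coe_ennreal_ofReal, max_eq_left hκ.le]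
  have h1 := condLExp_smul' (mΩ := m) (P := μ) (fun ω => ENNReal.ofReal (X ω))
    (ENNReal.ofReal_ne_top (r := κ))
  have h2 := condLExp_smul' (mΩ := m) (P := μ) (fun ω => ENNReal.ofReal (-X ω))
    (ENNReal.ofReal_ne_top (r := κ))
  filter_upwards [h1, h2] with ω h1 h2
  simp only [extCondExp, ← mul_neg]
  rw [hmul X, hmul fun ω => -X ω, h1, h2, Pi.smul_apply, Pi.smul_apply, smul_eq_mul, smul_eq_mul,
    EReal.coe_ennreal_mul, EReal.coe_ennreal_mul, hcoe,
    EReal.mul_sub_of_nonneg_of_ne_top (EReal.coe_nonneg.2 hκ.le) (EReal.coe_ne_top κ)]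

end CondLExp

/-! ### Nonnegativity of the conditional Tsallis relative entropy -/

/-- The tangent line at `1` lies below the convex function `x ↦ x ^ q * ln_q x`. -/
theorem sub_one_le_rpow_mul_lnq {q x : ℝ} (hq : 0 < q) (hq1 : q ≠ 1) (hx : 0 ≤ x) :
    x - 1 ≤ x ^ q * lnq q x := by
  rcases hx.eq_or_lt with rfl | hx
  · rw [Real.zero_rpow hq.ne']
    norm_num
  have hpow : x ^ q * x ^ (1 - q) = x := by
    rw [← Real.rpow_add hx, add_sub_cancel, Real.rpow_one]
  have hmul : x ^ q * lnq q x = (x - x ^ q) / (1 - q) := by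
    rw [lnq, mul_div_assoc', mul_sub, hpow, mul_one]
  rw [hmul]
  -- Bernoulli's inequality compares `x ^ q` with `1 + q (x - 1)`. Its direction flips at `q = 1`,
  -- as does the sign of the denominator `1 - q`.
  rcases lt_or_gt_of_ne hq1 with h | h
  · have hb := rpow_one_add_le_one_add_mul_self (s := x - 1) (by linarith) hq.le h.le
    rw [add_sub_cancel] at hb
    rw [le_div_iff₀ (by linarith)]
    linarith
  · have hb := one_add_mul_self_le_rpow_one_add (s := x - 1) (by linarith) h.le
    rw [add_sub_cancel] at hb
    rw [le_div_iff_of_neg (by linarith)]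
    linarith

section Entropy

variable {Ω : Type*} {mΩ : MeasurableSpace Ω} {𝓕 : Filtration ℝ≥0 mΩ} {Q μ : Measure Ω}

theorem measurable_densityAt (t : ℝ≥0) : Measurable (densityAt 𝓕 Q μ t) :=
  (stronglyMeasurable_condExp.mono (𝓕.le t)).measurable

theorem densityAt_nonneg (t : ℝ≥0) : 0 ≤ᵐ[μ] densityAt 𝓕 Q μ t :=
  condExp_nonneg (Eventually.of_forall fun _ => ENNReal.toReal_nonneg)

theorem measurable_densityRatio (s t : ℝ≥0) : Measurable (densityRatio 𝓕 Q μ s t) :=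
  (measurable_densityAt t).div (measurable_densityAt s)

theorem densityRatio_nonneg (s t : ℝ≥0) : 0 ≤ᵐ[μ] densityRatio 𝓕 Q μ s t := by
  filter_upwards [densityAt_nonneg (𝓕 := 𝓕) (Q := Q) (μ := μ) s, densityAt_nonneg t] with ω hs ht
  exact div_nonneg ht hs

/-- The ratio `D_{t,T}` has conditional expectation one given `𝓕_t`. -/
theorem condLExp_densityRatio [IsFiniteMeasure Q] (hμQ : μ ≪ Q) {t T : ℝ≥0}
    (hT : 𝓕 T = mΩ) [SigmaFinite (μ.trim (𝓕.le t))] :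
    condLExp (𝓕 t) μ (fun ω => ENNReal.ofReal (densityRatio 𝓕 Q μ t T ω)) =ᵐ[μ] 1 := by
  have : SigmaFinite μ := .of_trim (𝓕.le t)
  have hfin : ∫⁻ ω, Q.rnDeriv μ ω ∂μ ≠ ∞ := (Measure.lintegral_rnDeriv_lt_top Q μ).ne
  have hterm : densityAt 𝓕 Q μ T = fun ω => (Q.rnDeriv μ ω).toReal := by
    have : SigmaFinite (μ.trim le_rfl) := by rwa [trim_eq_self]
    unfold densityAt
    rw [hT, condExp_of_stronglyMeasurable le_rfl
      (Measure.measurable_rnDeriv Q μ).ennreal_toReal.stronglyMeasurable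
      Measure.integrable_toReal_rnDeriv]
  -- `D_t` is a.e. positive since `μ ≪ Q` and finite since `Q` is, so `1 / D_t` is a genuine
  -- `𝓕_t`-measurable factor that can be pulled out.
  have hratio : (fun ω => ENNReal.ofReal (densityRatio 𝓕 Q μ t T ω)) =ᵐ[μ]
      fun ω => Q.rnDeriv μ ω * (condLExp (𝓕 t) μ (Q.rnDeriv μ) ω)⁻¹ := by
    filter_upwards [toReal_condLExp (𝓕 t) (Measure.measurable_rnDeriv Q μ).aemeasurable hfin,
      condLExp_pos (𝓕.le t) (Measure.measurable_rnDeriv Q μ) (Measure.rnDeriv_pos' hμQ),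
      condLExp_ne_top hfin, Measure.rnDeriv_ne_top Q μ] with ω h1 h2 h3 h4
    have h5 : densityAt 𝓕 Q μ t ω = (condLExp (𝓕 t) μ (Q.rnDeriv μ) ω).toReal := h1.symm
    rw [densityRatio, hterm, h5, ENNReal.ofReal_div_of_pos (ENNReal.toReal_pos h2.ne' h3),
      ENNReal.ofReal_toReal h3, ENNReal.ofReal_toReal h4, div_eq_mul_inv]
  filter_upwards [condLExp_congr_ae hratio,
    condLExp_mul_of_measurable_right (𝓕.le t) (Measure.measurable_rnDeriv Q μ)
      (measurable_condLExp (𝓕 t) μ (Q.rnDeriv μ)).inv,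
    condLExp_pos (𝓕.le t) (Measure.measurable_rnDeriv Q μ) (Measure.rnDeriv_pos' hμQ),
    condLExp_ne_top hfin] with ω h1 h2 h3 h4
  rw [h1]
  exact h2.trans (ENNReal.mul_inv_cancel h3.ne' h4)

/-- The conditional Tsallis relative entropy is nonnegative. -/
theorem condTsallisEntropy_nonneg [IsFiniteMeasure Q] (hμQ : μ ≪ Q) {t T : ℝ≥0}
    (hT : 𝓕 T = mΩ) {q : ℝ} (hq : 0 < q) (hq1 : q ≠ 1) :
    0 ≤ᵐ[μ] condTsallisEntropy 𝓕 T q Q μ t := by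
  by_cases hσ : SigmaFinite (μ.trim (𝓕.le t))
  · refine extCondExp_nonneg_of_sub_one_le (𝓕.le t) (measurable_densityRatio t T)
      (densityRatio_nonneg t T) (condLExp_densityRatio hμQ hT) ?_
    filter_upwards [densityRatio_nonneg (𝓕 := 𝓕) (Q := Q) (μ := μ) t T] with ω hω
      using sub_one_le_rpow_mul_lnq hq hq1 hω
  -- Without σ-finiteness on `𝓕_t`, `condLExp` defaults to `0`, and the entropy is `0 - 0`.
  · refine Eventually.of_forall fun ω => ?_
    simp [condTsallisEntropy, extCondExp, condLExp_of_not_sigmaFinite (𝓕.le t) hσ]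

end Entropy

/-! ### Essential infima -/

section EssInf

variable {Ω : Type*} {mΩ : MeasurableSpace Ω} {μ : Measure Ω}

theorem isEssInfFamily_essInfFamily [IsFiniteMeasure μ] (S : Set (Ω → EReal)) :
    IsEssInfFamily μ S (essInfFamily μ S) :=
  Classical.choose_spec (exists_isEssInfFamily μ S)

theorem IsEssInfFamily.mono {S S' : Set (Ω → EReal)} {Y Y' : Ω → EReal}
    (hY : IsEssInfFamily μ S Y) (hY' : IsEssInfFamily μ S' Y')
    (h : ∀ X' ∈ S', ∃ X ∈ S, X ≤ᵐ[μ] X') : Y ≤ᵐ[μ] Y' := by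
  refine hY'.greatest Y hY.measurable fun X' hX' => ?_
  obtain ⟨X, hX, hle⟩ := h X' hX'
  exact (hY.le X hX).trans hle

theorem IsEssInfFamily.const_mul {S : Set (Ω → EReal)} {Y : Ω → EReal}
    (hY : IsEssInfFamily μ S Y) {κ : ℝ} (hκ : 0 < κ) :
    IsEssInfFamily μ ((fun X ω => (κ : EReal) * X ω) '' S) fun ω => (κ : EReal) * Y ω := by
  have hpos : ∀ {c : ℝ}, 0 < c → (0 : EReal) ≤ c := fun hc => EReal.coe_nonneg.2 hc.le
  have hcancel : ∀ {a b : ℝ}, a * b = 1 → ∀ x : EReal, (a : EReal) * ((b : EReal) * x) = x := by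
    intro a b hab x
    rw [← mul_assoc, ← EReal.coe_mul, hab, EReal.coe_one, one_mul]
  have hmeas : ∀ {c : ℝ}, 0 < c → Measurable fun x : EReal => (c : EReal) * x := fun hc =>
    Monotone.measurable fun _ _ h => mul_le_mul_of_nonneg_left h (hpos hc)
  refine ⟨(hmeas hκ).comp hY.measurable, ?_, fun Z hZ h => ?_⟩
  · rintro _ ⟨X, hX, rfl⟩
    filter_upwards [hY.le X hX] with ω hω using mul_le_mul_of_nonneg_left hω (hpos hκ)
  · have hκ' := inv_pos.2 hκ
    -- Scaling by `κ⁻¹` turns a lower bound of the scaled family into one of `S`.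
    have hle := hY.greatest (fun ω => ((κ⁻¹ : ℝ) : EReal) * Z ω) ((hmeas hκ').comp hZ) (by
      intro X hX
      filter_upwards [h _ ⟨X, hX, rfl⟩] with ω hω
      have := mul_le_mul_of_nonneg_left hω (hpos hκ')
      rwa [hcancel (inv_mul_cancel₀ hκ.ne')] at this)
    filter_upwards [hle] with ω hω
    have := mul_le_mul_of_nonneg_left hω (hpos hκ)
    rwa [hcancel (mul_inv_cancel₀ hκ.ne')] at this

end EssInf

/-! ### The pricing principle -/

namespace Market

variable {Ω : Type*} {mΩ : MeasurableSpace Ω} {P : Measure Ω} [P.IsComplete] {m n : ℕ}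
  {M : Market P m n} {q : ℝ}

theorem Qmin_absolutelyContinuous : M.Qmin ≪ M.PT :=
  withDensity_absolutelyContinuous _ _

theorem absolutelyContinuous_Qmin {Q : @Measure Ω M.sigmaT}
    (hQ : Q ∈ M.finiteEntropyMeasures q) : Q ≪ M.Qmin := by
  by_contra h
  have hlt := hQ.2
  rw [tsallisEntropy, if_neg h] at hlt
  exact lt_irrefl _ hlt

/-- `P ≪ Q ≪ Q^min`, the second because the entropy is `⊤` otherwise. This carries `Q^min`-a.e.
statements over to `P` without analysing the exponential density or the Itô integral. -/
theorem PT_absolutelyContinuous_Qmin {Q : @Measure Ω M.sigmaT}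
    (hQ : Q ∈ M.finiteEntropyMeasures q) : M.PT ≪ M.Qmin :=
  hQ.1.2.2.1.trans (absolutelyContinuous_Qmin hQ)

theorem condTsallisEntropy_nonneg {Q : @Measure Ω M.sigmaT}
    (hQ : Q ∈ M.finiteEntropyMeasures q) (hq : 0 < q) (hq1 : q ≠ 1) (t : ℝ≥0) :
    0 ≤ᵐ[M.PT] condTsallisEntropy M.filtration M.T q Q M.Qmin t := by
  have := hQ.1.1
  exact (PT_absolutelyContinuous_Qmin hQ).ae_le
    -- `rfl`: the ambient σ-algebra of the filtration is `𝓕_T` by definition.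
    (TsallisPricing.condTsallisEntropy_nonneg (Qmin_absolutelyContinuous.trans hQ.1.2.2.1) rfl hq hq1)

theorem penalizedValue_antitone {Q : @Measure Ω M.sigmaT}
    (hQ : Q ∈ M.finiteEntropyMeasures q) (hq : 0 < q) (hq1 : q ≠ 1) (t : ℝ≥0) (ξ : Ω → ℝ)
    {γ γ' : ℝ} (hγ : 0 < γ) (hγγ' : γ ≤ γ') :
    M.penalizedValue q t ξ γ' Q ≤ᵐ[M.PT] M.penalizedValue q t ξ γ Q := by
  filter_upwards [condTsallisEntropy_nonneg hQ hq hq1 t] with ω hω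
  refine add_le_add_right (mul_le_mul_of_nonneg_right ?_ hω) _
  exact EReal.coe_le_coe_iff.2 (one_div_le_one_div_of_le hγ hγγ')

theorem penalizedValue_const_mul {Q : @Measure Ω M.sigmaT}
    (hQ : Q ∈ M.finiteEntropyMeasures q) (t : ℝ≥0) (ξ : Ω → ℝ) {γ κ : ℝ} (hκ : 0 < κ) :
    M.penalizedValue q t (fun ω => κ * ξ ω) γ Q =ᵐ[M.PT]
      fun ω => (κ : EReal) * M.penalizedValue q t ξ (κ * γ) Q ω := by
  filter_upwards [(PT_absolutelyContinuous_Qmin hQ).ae_le (extCondExp_const_mul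
    (m := M.filtration t) hκ
    fun ω => densityRatio M.filtration Q M.Qmin t M.T ω ^ q * ξ ω)] with ω hω
  have hκγ : κ * (1 / (κ * γ)) = 1 / γ := by
    rw [one_div, mul_inv, mul_inv_cancel_left₀ hκ.ne', one_div]
  simp only [mul_left_comm _ κ, penalizedValue] at hω ⊢
  -- A finite factor `κ ≥ 0` distributes over every sum in `EReal`, even `∞ + (-∞)`.
  rw [hω, EReal.left_distrib_of_nonneg_of_ne_top (EReal.coe_nonneg.2 hκ.le) (EReal.coe_ne_top κ),
    ← mul_assoc (κ : EReal), ← EReal.coe_mul, hκγ]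

theorem price_antitone [IsProbabilityMeasure P] (hq : 0 < q) (hq1 : q ≠ 1) (t : ℝ≥0) (ξ : Ω → ℝ)
    {γ γ' : ℝ} (hγ : 0 < γ) (hγγ' : γ ≤ γ') :
    M.price q t ξ γ' ≤ᵐ[M.PT] M.price q t ξ γ := by
  refine (isEssInfFamily_essInfFamily _).mono (isEssInfFamily_essInfFamily _) ?_
  rintro _ ⟨Q, hQ, rfl⟩
  exact ⟨_, ⟨Q, hQ, rfl⟩, penalizedValue_antitone hQ hq hq1 t ξ hγ hγγ'⟩

theorem price_const_mul [IsProbabilityMeasure P] (t : ℝ≥0) (ξ : Ω → ℝ) {γ κ : ℝ} (hκ : 0 < κ) :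
    M.price q t (fun ω => κ * ξ ω) γ =ᵐ[M.PT]
      fun ω => (κ : EReal) * M.price q t ξ (κ * γ) ω := by
  have h1 : IsEssInfFamily M.PT _ (M.price q t (fun ω => κ * ξ ω) γ) :=
    isEssInfFamily_essInfFamily _
  have h2 : IsEssInfFamily M.PT _ fun ω => (κ : EReal) * M.price q t ξ (κ * γ) ω :=
    (isEssInfFamily_essInfFamily _).const_mul hκ
  -- The two families agree member by member only up to null sets, hence a comparison in each
  -- direction.
  refine (h1.mono h2 ?_).antisymm (h2.mono h1 ?_)
  · rintro _ ⟨_, ⟨Q, hQ, rfl⟩, rfl⟩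
    exact ⟨_, ⟨Q, hQ, rfl⟩, (penalizedValue_const_mul hQ t ξ hκ).le⟩
  · rintro _ ⟨Q, hQ, rfl⟩
    exact ⟨_, ⟨_, ⟨Q, hQ, rfl⟩, rfl⟩, (penalizedValue_const_mul hQ t ξ hκ).symm.le⟩

theorem boundedClaims_of_const_mul {Ω : Type*} {mΩ : MeasurableSpace Ω} {P : Measure Ω} {m n : ℕ}
    {M : Market P m n} {q : ℝ} {ξ : Ω → ℝ} {γ κ : ℝ} (hκ : 0 < κ)
    (hξ : (fun ω => κ * ξ ω) ∈ M.boundedClaims q γ) : ξ ∈ M.boundedClaims q (κ * γ) := by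
  have harg : ∀ ω, -γ * (κ * ξ ω) = -(κ * γ) * ξ ω := fun ω => by ring
  obtain ⟨⟨hm, hdom, hint, hexp⟩, hbdd⟩ := hξ
  simp only [harg] at hdom hint hexp hbdd
  refine ⟨⟨?_, hdom, hint, hexp⟩, hbdd⟩
  simpa [inv_mul_cancel_left₀ hκ.ne'] using hm.const_mul κ⁻¹

end Market

end TsallisPricing

theorem proposition5p0 {Ω : Type*} {mΩ : MeasurableSpace Ω} (P : Measure Ω)
    [IsProbabilityMeasure P] [P.IsComplete] {m n : ℕ} (M : TsallisPricing.Market P m n)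
    (q : ℝ) (hq : 0 < q) (hq1 : q ≠ 1) (t : ℝ≥0) (ht : t ≤ M.T) :
    (∀ (γ γ' : ℝ) (ξ : Ω → ℝ), 0 < γ → γ ≤ γ' →
      ξ ∈ M.boundedClaims q γ ∩ M.boundedClaims q γ' →
      M.price q t ξ γ' ≤ᵐ[P] M.price q t ξ γ) ∧
    (∀ (γ κ : ℝ) (ξ : Ω → ℝ), 0 < γ → 0 < κ →
      (fun ω => κ * ξ ω) ∈ M.boundedClaims q γ →
      ξ ∈ M.boundedClaims q (κ * γ) ∧
      M.price q t (fun ω => κ * ξ ω) γ =ᵐ[P] fun ω => (κ : EReal) * M.price q t ξ (κ * γ) ω) :=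
  ⟨fun _ _ ξ hγ hγγ' _ => ae_le_of_ae_le_trim
      (TsallisPricing.Market.price_antitone hq hq1 t ξ hγ hγγ'),
    fun _ _ ξ _ hκ hξ => ⟨TsallisPricing.Market.boundedClaims_of_const_mul hκ hξ,
      ae_eq_of_ae_eq_trim (TsallisPricing.Market.price_const_mul t ξ hκ)⟩⟩
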